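/- Let $M$ be a smooth (finite-dimensional, Hausdorff) manifold and let $\Omega^1(M)$ be the space of smooth 1-forms. A contravariant 2-tensor $P$ on $M$ is viewed as a smooth bundle morphism $P:T^*M\to TM$, with $\langle P,\alpha\wedge\beta\rangle=\langle\beta,P(\alpha)\rangle$; it is a Poisson tensor if it is skew-symmetric and $\{f,g\}^P=\langle P,df\wedge dg\rangle$ satisfies the Jacobi identity. For such a morphism $P$ put $$\mu^P(\alpha,\beta)=\mathcal L_{P(\alpha)}\beta-\mathcal L_{P(\beta)}\alpha-d\langle P,\alpha\wedge\beta\rangle,\qquad \alpha,\beta\in\Omega^1(M).$$ Let $N:T^*M\to T^*M$ be a smooth bundle morphism over $\mathrm{id}_M$, let ${}^tN:TM\to TM$ be its dual, let $E^1_x=N_x^{\dim M}(T^*_xM)$ be the component of the Riesz decomposition of $T^*_xM$ on which $N_x$ is invertible, and let $\mathcal A^1$ be the space of smooth 1-forms with values in $E^1$. For a bilinear product $\mu$ on $\Omega^1(M)$, $N$ is called a Saletan tensor for $\mu$ if the Nijenhuis torsion $$T_N\mu(\alpha,\beta)=\mu(N\alpha,N\beta)-N\big(\mu(N\alpha,\beta)+\mu(\alpha,N\beta)-N\mu(\alpha,\beta)\big)$$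 lies in $N(\mathcal A^1)$ for all $\alpha,\beta\in\Omega^1(M)$. The contraction $\mu_N$ of $\mu$ by $N$ is the product on $\Omega^1(M)$ given by the pointwise limit $$\mu_N(\alpha,\beta)=\lim_{\lambda\to0,\ \lambda\ne0}U(\lambda)^{-1}\mu\big(U(\lambda)\alpha,U(\lambda)\beta\big),\qquad U(\lambda)=\lambda I+N.$$ Theorem. Let $P$ be a Poisson tensor on $M$ and let $N$ be a Saletan tensor for $\mu^P$. Then the contraction $\mu^P_N$ exists, as a product on $\Omega^1(M)$, and there is a Poisson tensor $P_1$ on $M$ with $\mu^P_N=\mu^{P_1}$ if and only if (i) $PN={}^tN\,P$, and (ii) $\mu^P_N=\mu^{PN}$. Moreover, if $P_1$ is a Poisson tensor with $\mu^P_N=\mu^{P_1}$, then $P_1=PN$. -/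

import Mathlib

open Bundle Filter Topology
open scoped Manifold ContDiff Bundle

noncomputable section

namespace PoissonContraction

/-- The cotangent space `T*ₓM`. -/
abbrev CotangentFiber (E : Type*) [NormedAddCommGroup E] [NormedSpace ℝ E]
    {M : Type*} [TopologicalSpace M] [ChartedSpace E M] (x : M) : Type _ :=
  TangentSpace 𝓘(ℝ, E) x →L[ℝ] ℝ

section Bundles

variable (E : Type*) [NormedAddCommGroup E] [NormedSpace ℝ E]
  (M : Type*) [TopologicalSpace M] [ChartedSpace E M] [IsManifold 𝓘(ℝ, E) ∞ M]

/-- Smooth vector fields on `M`. -/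
abbrev VectorFields : Type _ :=
  Cₛ^∞⟮𝓘(ℝ, E); E, (TangentSpace 𝓘(ℝ, E) : M → Type _)⟯

/-- Smooth 1-forms on `M`, i.e. smooth sections of `T*M`. -/
abbrev OneForms : Type _ :=
  Cₛ^∞⟮𝓘(ℝ, E); E →L[ℝ] ℝ, fun x : M => CotangentFiber E x⟯

/-- Smooth vector bundle morphisms `T*M → TM` over the identity, as smooth sections of
`Hom(T*M, TM)`. A contravariant 2-tensor `P` is viewed as such a morphism. -/
abbrev ContravariantTensors : Type _ :=
  Cₛ^∞⟮𝓘(ℝ, E); (E →L[ℝ] ℝ) →L[ℝ] E,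
    fun x : M => CotangentFiber E x →L[ℝ] TangentSpace 𝓘(ℝ, E) x⟯

/-- Smooth vector bundle morphisms `T*M → T*M` over the identity, as smooth sections of
`Hom(T*M, T*M)`. -/
abbrev CotangentEndomorphisms : Type _ :=
  Cₛ^∞⟮𝓘(ℝ, E); (E →L[ℝ] ℝ) →L[ℝ] (E →L[ℝ] ℝ),
    fun x : M => CotangentFiber E x →L[ℝ] CotangentFiber E x⟯

end Bundles

variable {E : Type*} [NormedAddCommGroup E] [NormedSpace ℝ E]
  {M : Type*} [TopologicalSpace M] [ChartedSpace E M] [IsManifold 𝓘(ℝ, E) ∞ M]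

/-! ### Smoothness facts used by the definitions -/

theorem contMDiffAt_oneForm_apply {φ : ∀ x : M, CotangentFiber E x}
    {Y : ∀ x : M, TangentSpace 𝓘(ℝ, E) x} {x₀ : M}
    (hφ : ContMDiffAt 𝓘(ℝ, E) (𝓘(ℝ, E).prod 𝓘(ℝ, E →L[ℝ] ℝ)) ∞
      (fun x => TotalSpace.mk' (E →L[ℝ] ℝ) (E := fun x : M => CotangentFiber E x) x (φ x)) x₀)
    (hY : ContMDiffAt 𝓘(ℝ, E) (𝓘(ℝ, E).prod 𝓘(ℝ, E)) ∞
      (fun x => TotalSpace.mk' E x (Y x)) x₀) :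
    ContMDiffAt 𝓘(ℝ, E) 𝓘(ℝ, ℝ) ∞ (fun x => φ x (Y x)) x₀ := by
  have := hφ.clm_bundle_apply hY
  rw [contMDiffAt_section] at this
  exact this

theorem contMDiffAt_oneForm_of_apply [FiniteDimensional ℝ E]
    {φ : ∀ x : M, CotangentFiber E x} {x₀ : M}
    (h : ∀ Y : ∀ x : M, TangentSpace 𝓘(ℝ, E) x,
      ContMDiffAt 𝓘(ℝ, E) (𝓘(ℝ, E).prod 𝓘(ℝ, E)) ∞ (fun x => TotalSpace.mk' E x (Y x)) x₀ →
        ContMDiffAt 𝓘(ℝ, E) 𝓘(ℝ, ℝ) ∞ (fun x => φ x (Y x)) x₀) :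
    ContMDiffAt 𝓘(ℝ, E) (𝓘(ℝ, E).prod 𝓘(ℝ, E →L[ℝ] ℝ)) ∞
      (fun x => TotalSpace.mk' (E →L[ℝ] ℝ) (E := fun x : M => CotangentFiber E x) x (φ x)) x₀ := by
  rw [contMDiffAt_hom_bundle]
  refine ⟨contMDiffAt_id, ?_⟩
  let b := Module.finBasis ℝ E
  let t := trivializationAt E (TangentSpace 𝓘(ℝ, E) : M → Type _) x₀
  have hx : x₀ ∈ t.baseSet := FiberBundle.mem_baseSet_trivializationAt' x₀
  let L : (Fin (Module.finrank ℝ E) → ℝ) →L[ℝ] (E →L[ℝ] ℝ) :=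
    LinearMap.toContinuousLinearMap
      { toFun := fun c => ∑ i, c i • (b.coord i).toContinuousLinearMap
        map_add' := fun c d => by simp [add_smul, Finset.sum_add_distrib]
        map_smul' := fun r c => by simp [mul_smul, Finset.smul_sum] }
  have key : ContMDiffAt 𝓘(ℝ, E) 𝓘(ℝ, Fin (Module.finrank ℝ E) → ℝ) ∞
      (fun x => fun i => φ x (t.localFrame b i x)) x₀ :=
    contMDiffAt_pi_space.2 fun i => h _ (contMDiffAt_localFrame_of_mem ∞ _ b i hx)
  refine ((L.contMDiff.contMDiffAt (n := ∞)).comp x₀ key).congr_of_eventuallyEq ?_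
  filter_upwards [t.open_baseSet.mem_nhds hx] with x hxt
  ext v
  conv_lhs => rw [← b.sum_repr v]
  conv_rhs => rw [← b.sum_repr v]
  simp only [map_sum, map_smul]
  refine Finset.sum_congr rfl fun i _ => ?_
  congr 1
  have h1 : t.localFrame b i x = t.symm x (b i) := by
    rw [t.localFrame_apply_of_mem_baseSet b hxt]
    simp [Trivialization.basisAt]
  have h2 : L (fun i => φ x (t.localFrame b i x)) (b i) = φ x (t.localFrame b i x) := by
    simp only [L, LinearMap.coe_toContinuousLinearMap', LinearMap.coe_mk, AddHom.coe_mk,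
      sum_apply, smul_apply, Module.Basis.coord_apply,
      Module.Basis.repr_self, smul_eq_mul]
    rw [Finset.sum_eq_single i]
    · simp
    · intro j _ hj
      simp [hj.symm]
    · simp
  change _ = L (fun i => φ x (t.localFrame b i x)) (b i)
  rw [h2, h1]
  simp only [t] at hxt
  simp only [ContinuousLinearMap.inCoordinates, ContinuousLinearMap.comp_apply, t]
  erw [Trivialization.symmL_apply _ hxt]
  simp

theorem contMDiffAt_mvfderiv {f : M → ℝ} {x₀ : M}
    (hf : ContMDiffAt 𝓘(ℝ, E) 𝓘(ℝ, ℝ) ∞ f x₀) :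
    ContMDiffAt 𝓘(ℝ, E) (𝓘(ℝ, E).prod 𝓘(ℝ, E →L[ℝ] ℝ)) ∞
      (fun x => TotalSpace.mk' (E →L[ℝ] ℝ) (E := fun x : M => CotangentFiber E x) x
        (mvfderiv 𝓘(ℝ, E) f x)) x₀ := by
  rw [contMDiffAt_hom_bundle]
  refine ⟨contMDiffAt_id, ?_⟩
  have := hf.mfderiv_const (m := ∞) (by simp)
  refine this.congr_of_eventuallyEq (Eventually.of_forall fun x => ?_)
  ext v
  simp [inTangentCoordinates, ContinuousLinearMap.inCoordinates, mvfderiv]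
  rfl

theorem contMDiffAt_comp {P : ∀ x : M, CotangentFiber E x →L[ℝ] TangentSpace 𝓘(ℝ, E) x}
    {N : ∀ x : M, CotangentFiber E x →L[ℝ] CotangentFiber E x} {x₀ : M}
    (hP : ContMDiffAt 𝓘(ℝ, E) (𝓘(ℝ, E).prod 𝓘(ℝ, (E →L[ℝ] ℝ) →L[ℝ] E)) ∞
      (fun x => TotalSpace.mk' ((E →L[ℝ] ℝ) →L[ℝ] E)
        (E := fun x : M => CotangentFiber E x →L[ℝ] TangentSpace 𝓘(ℝ, E) x) x (P x)) x₀)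
    (hN : ContMDiffAt 𝓘(ℝ, E) (𝓘(ℝ, E).prod 𝓘(ℝ, (E →L[ℝ] ℝ) →L[ℝ] (E →L[ℝ] ℝ))) ∞
      (fun x => TotalSpace.mk' ((E →L[ℝ] ℝ) →L[ℝ] (E →L[ℝ] ℝ))
        (E := fun x : M => CotangentFiber E x →L[ℝ] CotangentFiber E x) x (N x)) x₀) :
    ContMDiffAt 𝓘(ℝ, E) (𝓘(ℝ, E).prod 𝓘(ℝ, (E →L[ℝ] ℝ) →L[ℝ] E)) ∞
      (fun x => TotalSpace.mk' ((E →L[ℝ] ℝ) →L[ℝ] E)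
        (E := fun x : M => CotangentFiber E x →L[ℝ] TangentSpace 𝓘(ℝ, E) x) x
        ((P x).comp (N x))) x₀ := by
  rw [contMDiffAt_hom_bundle] at hP hN ⊢
  refine ⟨contMDiffAt_id, ?_⟩
  refine (hP.2.clm_comp hN.2).congr_of_eventuallyEq ?_
  let t := trivializationAt (E →L[ℝ] ℝ) (fun x : M => CotangentFiber E x) x₀
  have hx : x₀ ∈ t.baseSet := FiberBundle.mem_baseSet_trivializationAt' x₀
  filter_upwards [t.open_baseSet.mem_nhds hx] with x hxt
  ext v
  simp only [ContinuousLinearMap.inCoordinates, ContinuousLinearMap.comp_apply]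
  rw [Trivialization.symmL_continuousLinearMapAt _ hxt]

/-! ### Cartan calculus for 1-forms -/

/-- The smooth function `⟨α, X⟩`. -/
def applyOneForm (α : OneForms E M) (X : VectorFields E M) : C^∞⟮𝓘(ℝ, E), M; ℝ⟯ :=
  ⟨fun x => α x (X x), fun x => contMDiffAt_oneForm_apply (α.contMDiff x) (X.contMDiff x)⟩

/-- The differential of a smooth function, as a smooth 1-form. -/
def differential (f : C^∞⟮𝓘(ℝ, E), M; ℝ⟯) : OneForms E M :=
  ⟨fun x => mvfderiv 𝓘(ℝ, E) f x, fun x => contMDiffAt_mvfderiv (f.contMDiff x)⟩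

theorem tensorialAt_lieDerivative [FiniteDimensional ℝ E] (X : VectorFields E M)
    (β : OneForms E M) (x : M) :
    TensorialAt 𝓘(ℝ, E) E (fun Y : ∀ y : M, TangentSpace 𝓘(ℝ, E) y =>
      mvfderiv 𝓘(ℝ, E) (fun y => β y (Y y)) x (X x)
        - β x (VectorField.mlieBracket 𝓘(ℝ, E) X Y x)) x where
  smul {f σ} hf hσ := by
    have h1 : MDifferentiableAt 𝓘(ℝ, E) 𝓘(ℝ, ℝ) (fun y => β y (σ y)) x := by
      have := (β.mdifferentiableAt (x := x)).clm_bundle_apply hσ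
      rw [mdifferentiableAt_section] at this
      exact this
    have h2 : (fun y => β y ((f • σ) y)) = f * (fun y => β y (σ y)) := by
      ext y; simp
    have : IsManifold 𝓘(ℝ, E) (minSmoothness ℝ 2) M := by
      simp; infer_instance
    rw [h2, mvfderiv_mul hf h1, VectorField.mlieBracket_smul_right hf hσ]
    simp
    ring
  add {σ τ} hσ hτ := by
    have h1 : MDifferentiableAt 𝓘(ℝ, E) 𝓘(ℝ, ℝ) (fun y => β y (σ y)) x := by
      have := (β.mdifferentiableAt (x := x)).clm_bundle_apply hσ
      rw [mdifferentiableAt_section] at this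
      exact this
    have h2 : MDifferentiableAt 𝓘(ℝ, E) 𝓘(ℝ, ℝ) (fun y => β y (τ y)) x := by
      have := (β.mdifferentiableAt (x := x)).clm_bundle_apply hτ
      rw [mdifferentiableAt_section] at this
      exact this
    have h3 : (fun y => β y ((σ + τ) y)) = (fun y => β y (σ y)) + (fun y => β y (τ y)) := by
      ext y; simp
    have : IsManifold 𝓘(ℝ, E) (minSmoothness ℝ 2) M := by
      simp; infer_instance
    rw [h3, mvfderiv_add h1 h2, VectorField.mlieBracket_add_right hσ hτ]
    simp
    ring

section FiniteDim

variable [FiniteDimensional ℝ E]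

/-- The value at `x` of the Lie derivative `ℒ_X β`: the covector determined by
`(ℒ_X β)(Y) = X(β(Y)) - β([X, Y])`. -/
def lieDerivativeAt (X : VectorFields E M) (β : OneForms E M) (x : M) : CotangentFiber E x :=
  TensorialAt.mkHom _ x (tensorialAt_lieDerivative X β x)

theorem lieDerivativeAt_apply (X : VectorFields E M) (β : OneForms E M) (x : M)
    {Y : ∀ y : M, TangentSpace 𝓘(ℝ, E) y}
    (hY : MDifferentiableAt 𝓘(ℝ, E) (𝓘(ℝ, E).prod 𝓘(ℝ, E))
      (fun y => TotalSpace.mk' E y (Y y)) x) :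
    lieDerivativeAt X β x (Y x) =
      mvfderiv 𝓘(ℝ, E) (fun y => β y (Y y)) x (X x)
        - β x (VectorField.mlieBracket 𝓘(ℝ, E) X Y x) :=
  TensorialAt.mkHom_apply (tensorialAt_lieDerivative X β x) hY

theorem contMDiffAt_lieDerivativeAt (X : VectorFields E M) (β : OneForms E M) (x₀ : M) :
    ContMDiffAt 𝓘(ℝ, E) (𝓘(ℝ, E).prod 𝓘(ℝ, E →L[ℝ] ℝ)) ∞
      (fun x => TotalSpace.mk' (E →L[ℝ] ℝ) (E := fun x : M => CotangentFiber E x) x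
        (lieDerivativeAt X β x)) x₀ := by
  refine contMDiffAt_oneForm_of_apply fun Y hY => ?_
  have hev : ∀ᶠ x in 𝓝 x₀, MDifferentiableAt 𝓘(ℝ, E) (𝓘(ℝ, E).prod 𝓘(ℝ, E))
      (fun y => TotalSpace.mk' E y (Y y)) x := by
    have h1 : ContMDiffAt 𝓘(ℝ, E) (𝓘(ℝ, E).prod 𝓘(ℝ, E)) 1
      (fun y => TotalSpace.mk' E y (Y y)) x₀ := hY.of_le (by simp)
    filter_upwards [(contMDiffAt_iff_contMDiffAt_nhds (by simp)).1 h1] with x hx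
    exact hx.mdifferentiableAt (by simp)
  have hbr : ContMDiffAt 𝓘(ℝ, E) (𝓘(ℝ, E).prod 𝓘(ℝ, E)) ∞
      (fun y => TotalSpace.mk' E y (VectorField.mlieBracket 𝓘(ℝ, E) X Y y)) x₀ := by
    have : IsManifold 𝓘(ℝ, E) (((⊤ : ℕ∞) : WithTop ℕ∞) + 1) M := by
      simpa using (inferInstance : IsManifold 𝓘(ℝ, E) ∞ M)
    have : IsManifold 𝓘(ℝ, E) (minSmoothness ℝ 2) M := by
      simp; infer_instance
    exact ContMDiffAt.mlieBracket_vectorField (m := ⊤) (n := ⊤) (X.contMDiff x₀) hY (by simp)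
  have h2 := (contMDiffAt_oneForm_apply
    (contMDiffAt_mvfderiv (contMDiffAt_oneForm_apply (β.contMDiff x₀) hY)) (X.contMDiff x₀)).sub
    (contMDiffAt_oneForm_apply (β.contMDiff x₀) hbr)
  refine h2.congr_of_eventuallyEq ?_
  filter_upwards [hev] with x hx
  exact lieDerivativeAt_apply X β x hx

/-- The Lie derivative `ℒ_X β` of a smooth 1-form along a smooth vector field. -/
def lieDerivative (X : VectorFields E M) (β : OneForms E M) : OneForms E M :=
  ⟨lieDerivativeAt X β, contMDiffAt_lieDerivativeAt X β⟩

end FiniteDim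

/-! ### Poisson tensors and the cotangent bracket -/

/-- The vector field `P(α)`. -/
def sharp (P : ContravariantTensors E M) (α : OneForms E M) : VectorFields E M :=
  ⟨fun x => P x (α x), P.contMDiff.clm_bundle_apply α.contMDiff⟩

/-- The function `⟨P, α ∧ β⟩ = ⟨β, P(α)⟩`. -/
def pairing (P : ContravariantTensors E M) (α β : OneForms E M) : C^∞⟮𝓘(ℝ, E), M; ℝ⟯ :=
  applyOneForm β (sharp P α)

/-- The bracket of functions `{f, g}^P = ⟨P, df ∧ dg⟩`. -/
def poissonBracket (P : ContravariantTensors E M) (f g : C^∞⟮𝓘(ℝ, E), M; ℝ⟯) :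
    C^∞⟮𝓘(ℝ, E), M; ℝ⟯ :=
  pairing P (differential f) (differential g)

/-- `P` is a Poisson tensor: a skew-symmetric contravariant 2-tensor whose bracket of functions
satisfies the Jacobi identity. -/
structure IsPoisson (P : ContravariantTensors E M) : Prop where
  skew : ∀ (x : M) (α β : CotangentFiber E x), β (P x α) = -α (P x β)
  jacobi : ∀ f g h : C^∞⟮𝓘(ℝ, E), M; ℝ⟯,
    poissonBracket P f (poissonBracket P g h) + poissonBracket P g (poissonBracket P h f)
      + poissonBracket P h (poissonBracket P f g) = 0

/-- The bracket
`μ^P(α, β) = [α, β]^P = ℒ_{P(α)} β - ℒ_{P(β)} α - d⟨P, α ∧ β⟩` of 1-forms. -/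
def cotangentBracket [FiniteDimensional ℝ E] (P : ContravariantTensors E M)
    (α β : OneForms E M) : OneForms E M :=
  lieDerivative (sharp P α) β - lieDerivative (sharp P β) α - differential (pairing P α β)

/-! ### Contractions of products of 1-forms -/

/-- The 1-form `N(α)`. -/
def applyEnd (N : CotangentEndomorphisms E M) (α : OneForms E M) : OneForms E M :=
  ⟨fun x => N x (α x), N.contMDiff.clm_bundle_apply α.contMDiff⟩

/-- The composition `PN : T*M → TM`. -/
def compEnd (P : ContravariantTensors E M) (N : CotangentEndomorphisms E M) :
    ContravariantTensors E M :=
  ⟨fun x => (P x).comp (N x), fun x => contMDiffAt_comp (P.contMDiff x) (N.contMDiff x)⟩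

/-- `δ_N μ(α, β) = μ(Nα, β) + μ(α, Nβ) - N μ(α, β)`. -/
def deformedProduct (μ : OneForms E M → OneForms E M → OneForms E M)
    (N : CotangentEndomorphisms E M) (α β : OneForms E M) : OneForms E M :=
  μ (applyEnd N α) β + μ α (applyEnd N β) - applyEnd N (μ α β)

/-- The Nijenhuis torsion `T_N μ(α, β) = μ(Nα, Nβ) - N(δ_N μ(α, β))`. -/
def torsion (μ : OneForms E M → OneForms E M → OneForms E M)
    (N : CotangentEndomorphisms E M) (α β : OneForms E M) : OneForms E M :=
  μ (applyEnd N α) (applyEnd N β) - applyEnd N (deformedProduct μ N α β)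

/-- The component `E¹ₓ = Nₓⁿ(T*ₓM)`, `n = dim T*ₓM`, of the Riesz decomposition of `T*ₓM` with
respect to `Nₓ`, on which `Nₓ` is invertible. -/
def rieszComponent (N : CotangentEndomorphisms E M) (x : M) : Submodule ℝ (CotangentFiber E x) :=
  LinearMap.range ((N x : Module.End ℝ (CotangentFiber E x))
    ^ Module.finrank ℝ (CotangentFiber E x))

/-- `N` is a Saletan tensor for `μ`: the Nijenhuis torsion takes values in `N(𝒜¹)`, where `𝒜¹` is
the space of smooth 1-forms with values in the Riesz component `E¹`. -/
def IsSaletan (μ : OneForms E M → OneForms E M → OneForms E M)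
    (N : CotangentEndomorphisms E M) : Prop :=
  ∀ α β : OneForms E M, ∃ τ : OneForms E M,
    (∀ x, τ x ∈ rieszComponent N x) ∧ applyEnd N τ = torsion μ N α β

/-- `ν` is the contraction `μ_N` of `μ` by `N`: with `U(t) = t I + N`,
`ν(α, β) = lim_{t → 0, t ≠ 0} U(t)⁻¹ μ(U(t) α, U(t) β)` at every point. For `t ≠ 0` close to `0`,
depending on the point, `U(t)` is invertible there. -/
def IsContraction (μ : OneForms E M → OneForms E M → OneForms E M)
    (N : CotangentEndomorphisms E M) (ν : OneForms E M → OneForms E M → OneForms E M) : Prop :=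
  ∀ (α β : OneForms E M) (x : M),
    Tendsto (fun t : ℝ =>
        (t • ContinuousLinearMap.id ℝ (CotangentFiber E x) + N x).inverse
          (μ (t • α + applyEnd N α) (t • β + applyEnd N β) x))
      (𝓝[≠] 0) (𝓝 (ν α β x))

/-! ### The dual morphism -/

section Dual

variable [FiniteDimensional ℝ E]

instance finiteDimensional_tangentSpace (x : M) :
    FiniteDimensional ℝ (TangentSpace 𝓘(ℝ, E) x) :=
  inferInstanceAs (FiniteDimensional ℝ E)

instance t2Space_tangentSpace (x : M) : T2Space (TangentSpace 𝓘(ℝ, E) x) :=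
  inferInstanceAs (T2Space E)

/-- `Nₓ` as a linear endomorphism of the algebraic dual of `TₓM`, which is the same space as
`T*ₓM` because `TₓM` is finite-dimensional. -/
def algebraicEnd (N : CotangentEndomorphisms E M) (x : M) :
    Module.Dual ℝ (TangentSpace 𝓘(ℝ, E) x) →ₗ[ℝ] Module.Dual ℝ (TangentSpace 𝓘(ℝ, E) x) :=
  (LinearMap.toContinuousLinearMap
      (𝕜 := ℝ) (E := TangentSpace 𝓘(ℝ, E) x) (F' := ℝ)).symm.toLinearMap ∘ₗ
    (N x).toLinearMap ∘ₗ
    (LinearMap.toContinuousLinearMap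
      (𝕜 := ℝ) (E := TangentSpace 𝓘(ℝ, E) x) (F' := ℝ)).toLinearMap

/-- The dual `ᵗNₓ : TₓM → TₓM` of `Nₓ : T*ₓM → T*ₓM`, using `T**ₓM = TₓM`. -/
def dualEnd (N : CotangentEndomorphisms E M) (x : M) :
    TangentSpace 𝓘(ℝ, E) x →L[ℝ] TangentSpace 𝓘(ℝ, E) x :=
  LinearMap.toContinuousLinearMap
    ((Module.evalEquiv ℝ (TangentSpace 𝓘(ℝ, E) x)).symm.toLinearMap ∘ₗ
      (algebraicEnd N x).dualMap ∘ₗ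
      (Module.evalEquiv ℝ (TangentSpace 𝓘(ℝ, E) x)).toLinearMap)

theorem apply_dualEnd (N : CotangentEndomorphisms E M) (x : M) (α : CotangentFiber E x)
    (v : TangentSpace 𝓘(ℝ, E) x) : α (dualEnd N x v) = N x α v :=
  Module.apply_evalEquiv_symm_apply (R := ℝ) (M := TangentSpace 𝓘(ℝ, E) x)
    (α : TangentSpace 𝓘(ℝ, E) x →ₗ[ℝ] ℝ) _

end Dual

end PoissonContraction

end

open PoissonContraction

/-!
For skew-symmetric `P`, the product `μ^P` satisfies a Leibniz rule with anchor `P`, and a product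
has at most one anchor. Passing to the limit in the Leibniz rule shows that every contraction of
`μ^P` by `N` has anchor `PN`, so `μ^P_N = μ^{P₁}` forces `P₁ = PN`; and (i) says that `PN` is
skew-symmetric. For the converse, a skew-symmetric `P` is a Poisson tensor exactly when
`P μ^P(α, β) = [P(α), P(β)]`, and `N μ_N(α, β) = μ(Nα, Nβ)` transports this property to `PN`.

The contraction itself exists because `U(λ)⁻¹ μ(U(λ)α, U(λ)β)` is affine in `λ` up to the term
`U(λ)⁻¹ T_N μ(α, β)`, and `U(λ)⁻¹ N → I` on the Riesz component of `N`.
-/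

noncomputable section

namespace PoissonContraction

section LinearAlgebra

theorem eq_zero_of_mem_range_pow_finrank {K V : Type*} [Field K] [AddCommGroup V] [Module K V]
    [FiniteDimensional K V] {A : Module.End K V} {v : V}
    (hv : v ∈ LinearMap.range (A ^ Module.finrank K V)) (hAv : A v = 0) : v = 0 := by
  obtain ⟨w, rfl⟩ := hv
  have hw : w ∈ LinearMap.ker (A ^ (Module.finrank K V + 1)) := by
    rw [LinearMap.mem_ker, pow_succ']
    exact hAv
  rwa [Module.End.ker_pow_eq_ker_pow_finrank_of_le (Nat.le_succ _)] at hw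

theorem mapsTo_range_pow {R V : Type*} [Semiring R] [AddCommMonoid V] [Module R V]
    (A : Module.End R V) (n : ℕ) :
    Set.MapsTo A (LinearMap.range (A ^ n)) (LinearMap.range (A ^ n)) := by
  rintro _ ⟨w, rfl⟩
  exact ⟨A w, by rw [← Module.End.mul_apply, ← pow_succ, pow_succ', Module.End.mul_apply]⟩

variable {V : Type*} [NormedAddCommGroup V] [NormedSpace ℝ V]

theorem tendsto_inverse_smul_id_add [CompleteSpace V] {A : V →L[ℝ] V} (hA : A.IsInvertible) :
    Tendsto (fun t : ℝ => (t • ContinuousLinearMap.id ℝ V + A).inverse) (𝓝 0) (𝓝 A.inverse) := by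
  have hU : Tendsto (fun t : ℝ => t • ContinuousLinearMap.id ℝ V + A) (𝓝 0) (𝓝 A) := by
    have : Continuous fun t : ℝ => t • ContinuousLinearMap.id ℝ V + A := by fun_prop
    simpa only [zero_smul, zero_add] using this.tendsto 0
  exact (hA.contDiffAt_map_inverse (n := 0)).continuousAt.tendsto.comp hU

variable [FiniteDimensional ℝ V]

theorem isInvertible_of_injective {A : V →L[ℝ] V} (hA : Function.Injective A) : A.IsInvertible :=
  ⟨(LinearEquiv.ofInjectiveEndo (A : V →ₗ[ℝ] V) hA).toContinuousLinearEquiv, rfl⟩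

theorem eventually_isInvertible_smul_id_add (A : V →L[ℝ] V) :
    ∀ᶠ t in 𝓝[≠] (0 : ℝ), (t • ContinuousLinearMap.id ℝ V + A).IsInvertible := by
  have hfin : {t : ℝ | Module.End.HasEigenvalue (A : Module.End ℝ V) (-t)}.Finite :=
    (Module.End.finite_hasEigenvalue (A : Module.End ℝ V)).preimage neg_injective.injOn
  filter_upwards [nhdsNE_le_cofinite 0 hfin.compl_mem_cofinite] with t ht
  refine isInvertible_of_injective ((injective_iff_map_eq_zero _).2 fun v hv => ?_)
  by_contra hv0
  have hAv : A v = -t • v := by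
    rw [neg_smul]
    exact (neg_eq_of_add_eq_zero_right hv).symm
  exact ht (Module.End.hasEigenvalue_of_hasEigenvector
    (Module.End.hasEigenvector_iff.2 ⟨Module.End.mem_eigenspace_iff.2 hAv, hv0⟩))

theorem tendsto_inverse_smul_id_add_apply (A : V →L[ℝ] V) {v : V}
    (hv : v ∈ LinearMap.range ((A : Module.End ℝ V) ^ Module.finrank ℝ V)) :
    Tendsto (fun t : ℝ => (t • ContinuousLinearMap.id ℝ V + A).inverse (A v)) (𝓝[≠] 0) (𝓝 v) := by
  set W := LinearMap.range ((A : Module.End ℝ V) ^ Module.finrank ℝ V)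
  let B : W →L[ℝ] W := A.restrict (mapsTo_range_pow (A : Module.End ℝ V) _)
  have hB : B.IsInvertible :=
    isInvertible_of_injective <| (injective_iff_map_eq_zero _).2 fun w hw =>
      Subtype.ext (eq_zero_of_mem_range_pow_finrank w.2 (congrArg Subtype.val hw))
  let w (t : ℝ) : W := (t • ContinuousLinearMap.id ℝ W + B).inverse (B ⟨v, hv⟩)
  have hw : Tendsto w (𝓝 0) (𝓝 ⟨v, hv⟩) := by
    have := ((ContinuousLinearMap.apply ℝ W (B ⟨v, hv⟩)).continuous.tendsto _).comp
      (tendsto_inverse_smul_id_add hB)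
    rwa [ContinuousLinearMap.apply_apply, hB.inverse_apply_self] at this
  refine ((continuous_subtype_val.tendsto _).comp (hw.mono_left nhdsWithin_le_nhds)).congr' ?_
  filter_upwards [eventually_isInvertible_smul_id_add A, eventually_isInvertible_smul_id_add B]
    with t hA' hB'
  exact (hA'.inverse_apply_eq.2
    (congrArg Subtype.val (hB'.self_apply_inverse (B ⟨v, hv⟩))).symm).symm

end LinearAlgebra

variable {E : Type*} [NormedAddCommGroup E] [NormedSpace ℝ E]
  {M : Type*} [TopologicalSpace M] [ChartedSpace E M]

section Sections

variable {F : Type*} [NormedAddCommGroup F] [NormedSpace ℝ F]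
  {V : M → Type*} [TopologicalSpace (TotalSpace F V)] [∀ x, AddCommGroup (V x)]
  [∀ x, Module ℝ (V x)] [∀ x, TopologicalSpace (V x)] [FiberBundle F V] [VectorBundle ℝ F V]

/-- Pointwise multiplication of smooth sections by smooth functions. -/
instance smulSection : SMul C^∞⟮𝓘(ℝ, E), M; ℝ⟯ Cₛ^∞⟮𝓘(ℝ, E); F, V⟯ where
  smul f s := ⟨fun x => f x • s x, f.contMDiff.smul_section s.contMDiff⟩

theorem smulSection_apply (f : C^∞⟮𝓘(ℝ, E), M; ℝ⟯) (s : Cₛ^∞⟮𝓘(ℝ, E); F, V⟯) (x : M) :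
    (f • s) x = f x • s x :=
  rfl

end Sections

variable [IsManifold 𝓘(ℝ, E) ∞ M]

instance isManifold_minSmoothness_three : IsManifold 𝓘(ℝ, E) (minSmoothness ℝ 3) M := by
  simp only [minSmoothness_of_isRCLikeNormedField]
  infer_instance

theorem mdifferentiableAt_oneForm_apply (β : OneForms E M) {Y : ∀ y : M, TangentSpace 𝓘(ℝ, E) y}
    {x : M} (hY : MDiffAt (T% Y) x) : MDiffAt (fun y => β y (Y y)) x := by
  have := (β.mdifferentiableAt (x := x)).clm_bundle_apply hY
  rwa [mdifferentiableAt_section] at this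

theorem cotangent_ext_of_section [FiniteDimensional ℝ E] {x : M} {a b : CotangentFiber E x}
    (h : ∀ Y : ∀ y : M, TangentSpace 𝓘(ℝ, E) y, MDiffAt (T% Y) x → a (Y x) = b (Y x)) : a = b := by
  ext v
  simpa using h (FiberBundle.extend E v) (FiberBundle.mdifferentiableAt_extend ..)

theorem applyOneForm_apply (α : OneForms E M) (X : VectorFields E M) (x : M) :
    applyOneForm α X x = α x (X x) :=
  rfl

theorem applyOneForm_neg (α : OneForms E M) (X : VectorFields E M) :
    applyOneForm α (-X) = -applyOneForm α X :=
  ContMDiffMap.ext fun x => (α x).map_neg (X x)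

theorem applyOneForm_sub (α : OneForms E M) (X Y : VectorFields E M) :
    applyOneForm α (X - Y) = applyOneForm α X - applyOneForm α Y :=
  ContMDiffMap.ext fun x => (α x).map_sub (X x) (Y x)

/-- The derivative `X(f)` of a smooth function along a smooth vector field. -/
def derivAlong (X : VectorFields E M) (f : C^∞⟮𝓘(ℝ, E), M; ℝ⟯) : C^∞⟮𝓘(ℝ, E), M; ℝ⟯ :=
  applyOneForm (differential f) X

theorem derivAlong_apply (X : VectorFields E M) (f : C^∞⟮𝓘(ℝ, E), M; ℝ⟯) (x : M) :
    derivAlong X f x = mvfderiv 𝓘(ℝ, E) f x (X x) :=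
  rfl

section Differential

variable (f g : C^∞⟮𝓘(ℝ, E), M; ℝ⟯)

theorem differential_neg : differential (-f) = -differential f :=
  ContMDiffSection.ext fun _ => mvfderiv_neg

theorem derivAlong_neg (X : VectorFields E M) (f : C^∞⟮𝓘(ℝ, E), M; ℝ⟯) :
    derivAlong X (-f) = -derivAlong X f := by
  rw [derivAlong, differential_neg]
  rfl

theorem differential_add : differential (f + g) = differential f + differential g :=
  ContMDiffSection.ext fun x => mvfderiv_add (f.contMDiff.mdifferentiable (by simp) x)
    (g.contMDiff.mdifferentiable (by simp) x)

theorem differential_mul : differential (f * g) = f • differential g + g • differential f :=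
  ContMDiffSection.ext fun x => mvfderiv_mul (f.contMDiff.mdifferentiable (by simp) x)
    (g.contMDiff.mdifferentiable (by simp) x)

theorem differential_const (c : ℝ) :
    differential (ContMDiffMap.const c : C^∞⟮𝓘(ℝ, E), M; ℝ⟯) = 0 :=
  ContMDiffSection.ext fun _ => mvfderiv_const c

end Differential

section LieBracket

variable [CompleteSpace E]

/-- The Lie bracket `[X, Y]` as a smooth vector field. -/
def lieBracket (X Y : VectorFields E M) : VectorFields E M :=
  ⟨VectorField.mlieBracket 𝓘(ℝ, E) X Y, fun x =>
    have : IsManifold 𝓘(ℝ, E) (((⊤ : ℕ∞) : WithTop ℕ∞) + 1) M := by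
      simpa using (inferInstance : IsManifold 𝓘(ℝ, E) ∞ M)
    ContMDiffAt.mlieBracket_vectorField (m := ⊤) (n := ⊤) (X.contMDiff x) (Y.contMDiff x)
      (by simp)⟩

theorem lieBracket_swap (X Y : VectorFields E M) : lieBracket X Y = -lieBracket Y X :=
  ContMDiffSection.ext fun _ => VectorField.mlieBracket_swap_apply

theorem lieBracket_add_right (X Y Z : VectorFields E M) :
    lieBracket X (Y + Z) = lieBracket X Y + lieBracket X Z :=
  ContMDiffSection.ext fun _ =>
    VectorField.mlieBracket_add_right Y.mdifferentiableAt Z.mdifferentiableAt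

theorem lieBracket_smul_right (X Y : VectorFields E M) (f : C^∞⟮𝓘(ℝ, E), M; ℝ⟯) :
    lieBracket X (f • Y) = derivAlong X f • Y + f • lieBracket X Y :=
  ContMDiffSection.ext fun x =>
    VectorField.mlieBracket_smul_right (f.contMDiff.mdifferentiable (by simp) x) Y.mdifferentiableAt

theorem lieBracket_leibniz (X Y Z : VectorFields E M) :
    lieBracket X (lieBracket Y Z) =
      lieBracket (lieBracket X Y) Z + lieBracket Y (lieBracket X Z) :=
  ContMDiffSection.ext fun x => by
    have h (W : VectorFields E M) : CMDiffAt (minSmoothness ℝ 2) (T% (fun y => W y)) x :=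
      (W.contMDiff x).of_le (by
        rw [minSmoothness_of_isRCLikeNormedField]
        exact WithTop.coe_le_coe.2 (le_top : (2 : ℕ∞) ≤ ⊤))
    exact VectorField.leibniz_identity_mlieBracket_apply (h X) (h Y) (h Z)

theorem derivAlong_lieBracket (X Y : VectorFields E M) (f : C^∞⟮𝓘(ℝ, E), M; ℝ⟯) :
    derivAlong (lieBracket X Y) f =
      derivAlong X (derivAlong Y f) - derivAlong Y (derivAlong X f) := by
  ext x
  let d : ℝ := derivAlong (lieBracket X Y) f x
    - (derivAlong X (derivAlong Y f) x - derivAlong Y (derivAlong X f) x)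
  have hd (Z : VectorFields E M) : d • Z x = 0 := by
    have hL : lieBracket X (lieBracket Y (f • Z)) =
        derivAlong X (derivAlong Y f) • Z + derivAlong Y f • lieBracket X Z
          + (derivAlong X f • lieBracket Y Z + f • lieBracket X (lieBracket Y Z)) := by
      simp only [lieBracket_smul_right, lieBracket_add_right]
    have hR : lieBracket Y (lieBracket X (f • Z)) =
        derivAlong Y (derivAlong X f) • Z + derivAlong X f • lieBracket Y Z
          + (derivAlong Y f • lieBracket X Z + f • lieBracket Y (lieBracket X Z)) := by
      simp only [lieBracket_smul_right, lieBracket_add_right]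
    have h := lieBracket_leibniz X Y (f • Z)
    rw [hL, hR, lieBracket_smul_right, lieBracket_leibniz X Y Z] at h
    have hx := DFunLike.congr_fun h x
    simp only [ContMDiffSection.coe_add, Pi.add_apply, smulSection_apply] at hx
    linear_combination (norm := module) -hx
  suffices d = 0 from sub_eq_zero.1 this
  by_cases hX : X x = 0
  · by_cases hY : Y x = 0
    · have h0 : lieBracket X Y x = 0 := by
        have := VectorField.mlieBracketWithin_eq_zero_of_eq_zero (I := 𝓘(ℝ, E)) (s := .univ) hX hY
        rwa [VectorField.mlieBracketWithin_univ] at this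
      simp [d, derivAlong_apply, h0, hX, hY]
    · exact (smul_eq_zero.1 (hd Y)).resolve_right hY
  · exact (smul_eq_zero.1 (hd X)).resolve_right hX

end LieBracket

section Separation

variable [FiniteDimensional ℝ E]

theorem exists_differential_eq [T2Space M] {x : M} (a : CotangentFiber E x) :
    ∃ f : C^∞⟮𝓘(ℝ, E), M; ℝ⟯, differential f x = a := by
  obtain ⟨χ⟩ : Nonempty (SmoothBumpFunction 𝓘(ℝ, E) x) := inferInstance
  let a' : E →L[ℝ] ℝ := a
  let g (y : M) : ℝ := a' (extChartAt 𝓘(ℝ, E) x y)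
  have hg : CMDiff[(chartAt E x).source] ∞ g :=
    a'.contMDiff.comp_contMDiffOn contMDiffOn_extChartAt
  refine ⟨⟨fun y => χ y • g y, χ.contMDiff_smul hg⟩, ?_⟩
  have hχ : (fun y => χ y • g y) =ᶠ[𝓝 x] g := by
    filter_upwards [χ.eventuallyEq_one] with y hy
    rw [hy, Pi.one_apply, one_smul]
  have hda : mfderiv 𝓘(ℝ, E) 𝓘(ℝ, ℝ) (fun y => χ y • g y) x =
      (mfderiv 𝓘(ℝ, E) 𝓘(ℝ, ℝ) a' (extChartAt 𝓘(ℝ, E) x x)).comp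
        (mfderiv 𝓘(ℝ, E) 𝓘(ℝ, E) (extChartAt 𝓘(ℝ, E) x) x) := by
    rw [hχ.mfderiv_eq]
    exact mfderiv_comp x a'.mdifferentiableAt
      (mdifferentiableAt_extChartAt (mem_chart_source E x))
  rw [mfderiv_extChartAt_self, mfderiv_eq_fderiv, a'.fderiv] at hda
  exact ContinuousLinearMap.ext fun v => DFunLike.congr_fun hda v

theorem tangent_eq_of_forall_differential [T2Space M] {x : M} {v w : TangentSpace 𝓘(ℝ, E) x}
    (h : ∀ f : C^∞⟮𝓘(ℝ, E), M; ℝ⟯, differential f x v = differential f x w) : v = w :=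
  (SeparatingDual.eq_iff_forall_dual_eq (R := ℝ) (V := E)).2 fun a => by
    obtain ⟨f, rfl⟩ := exists_differential_eq (x := x) a
    exact h f

end Separation

section LieDerivative

variable [FiniteDimensional ℝ E]

theorem lieDerivative_apply (X : VectorFields E M) (β : OneForms E M) {x : M}
    {Z : ∀ y : M, TangentSpace 𝓘(ℝ, E) y} (hZ : MDiffAt (T% Z) x) :
    lieDerivative X β x (Z x) =
      mvfderiv 𝓘(ℝ, E) (fun y => β y (Z y)) x (X x)
        - β x (VectorField.mlieBracket 𝓘(ℝ, E) X Z x) :=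
  lieDerivativeAt_apply X β x hZ

theorem applyOneForm_lieDerivative (X Y : VectorFields E M) (β : OneForms E M) :
    applyOneForm (lieDerivative X β) Y =
      derivAlong X (applyOneForm β Y) - applyOneForm β (lieBracket X Y) :=
  ContMDiffMap.ext fun _ => lieDerivative_apply X β Y.mdifferentiableAt

variable (X Y : VectorFields E M) (α β : OneForms E M) (f : C^∞⟮𝓘(ℝ, E), M; ℝ⟯)

theorem lieDerivative_add_left :
    lieDerivative (X + Y) β = lieDerivative X β + lieDerivative Y β := by
  refine ContMDiffSection.ext fun x => cotangent_ext_of_section fun Z hZ => ?_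
  simp only [ContMDiffSection.coe_add, Pi.add_apply, add_apply, lieDerivative_apply _ _ hZ,
    VectorField.mlieBracket_add_left X.mdifferentiableAt Y.mdifferentiableAt, map_add]
  ring

theorem lieDerivative_add_right :
    lieDerivative X (α + β) = lieDerivative X α + lieDerivative X β := by
  refine ContMDiffSection.ext fun x => cotangent_ext_of_section fun Z hZ => ?_
  simp only [ContMDiffSection.coe_add, Pi.add_apply, add_apply, lieDerivative_apply _ _ hZ]
  rw [mvfderiv_fun_add (mdifferentiableAt_oneForm_apply α hZ)
    (mdifferentiableAt_oneForm_apply β hZ), add_apply]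
  ring

theorem lieDerivative_smul_left :
    lieDerivative (f • X) β = f • lieDerivative X β + applyOneForm β X • differential f := by
  refine ContMDiffSection.ext fun x => cotangent_ext_of_section fun Z hZ => ?_
  have hbr : VectorField.mlieBracket 𝓘(ℝ, E) (f • X) Z x =
      -(differential f x (Z x)) • X x + f x • VectorField.mlieBracket 𝓘(ℝ, E) X Z x :=
    VectorField.mlieBracket_smul_left (f.contMDiff.mdifferentiable (by simp) x) X.mdifferentiableAt
  simp only [ContMDiffSection.coe_add, Pi.add_apply, add_apply, lieDerivative_apply _ _ hZ,
    smulSection_apply, smul_apply, hbr, map_add, map_smul, smul_eq_mul, applyOneForm_apply]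
  ring

theorem lieDerivative_smul_right :
    lieDerivative X (f • β) = f • lieDerivative X β + derivAlong X f • β := by
  refine ContMDiffSection.ext fun x => cotangent_ext_of_section fun Z hZ => ?_
  have hd : mvfderiv 𝓘(ℝ, E) (fun y => f y * β y (Z y)) x =
      f x • mvfderiv 𝓘(ℝ, E) (fun y => β y (Z y)) x + β x (Z x) • differential f x :=
    mvfderiv_mul (f.contMDiff.mdifferentiable (by simp) x) (mdifferentiableAt_oneForm_apply β hZ)
  simp only [ContMDiffSection.coe_add, Pi.add_apply, add_apply, lieDerivative_apply _ _ hZ, hd,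
    smulSection_apply, smul_apply, smul_eq_mul, derivAlong, applyOneForm_apply]
  ring

end LieDerivative

section Anchor

/-- The tensor `ρ : T*M → TM` is an anchor of the product `μ` on 1-forms: `μ` satisfies the Leibniz
rule `μ(α, fβ) = f μ(α, β) + ρ(α)(f) β`. -/
def HasAnchor (μ : OneForms E M → OneForms E M → OneForms E M) (ρ : ContravariantTensors E M) :
    Prop :=
  ∀ (α β : OneForms E M) (f : C^∞⟮𝓘(ℝ, E), M; ℝ⟯),
    μ α (f • β) = f • μ α β + derivAlong (sharp ρ α) f • β

theorem HasAnchor.unique [FiniteDimensional ℝ E] [T2Space M]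
    {μ : OneForms E M → OneForms E M → OneForms E M} {ρ ρ' : ContravariantTensors E M}
    (hρ : HasAnchor μ ρ) (hρ' : HasAnchor μ ρ') : ρ = ρ' := by
  refine ContMDiffSection.ext fun x => ContinuousLinearMap.ext fun a =>
    tangent_eq_of_forall_differential fun f => ?_
  obtain ⟨g, rfl⟩ := exists_differential_eq a
  by_cases hf : differential f x = 0
  · rw [hf, zero_apply, zero_apply]
  have h := DFunLike.congr_fun ((hρ (differential g) (differential f) f).symm.trans
    (hρ' (differential g) (differential f) f)) x
  exact smul_left_injective ℝ hf (add_left_cancel h)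

end Anchor

section Contraction

variable {μ ν : OneForms E M → OneForms E M → OneForms E M} {ρ : ContravariantTensors E M}
  {N : CotangentEndomorphisms E M}

theorem applyEnd_apply (N : CotangentEndomorphisms E M) (α : OneForms E M) (x : M) :
    applyEnd N α x = N x (α x) :=
  rfl

theorem applyEnd_smul (N : CotangentEndomorphisms E M) (f : C^∞⟮𝓘(ℝ, E), M; ℝ⟯)
    (α : OneForms E M) : applyEnd N (f • α) = f • applyEnd N α :=
  ContMDiffSection.ext fun x => (N x).map_smul (f x) (α x)

theorem apply_pencil_apply_pencil (hμ : IsBilinearMap ℝ μ) (α β : OneForms E M)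
    (t : ℝ) :
    μ (t • α + applyEnd N α) (t • β + applyEnd N β) =
      t • (t • μ α β + deformedProduct μ N α β + applyEnd N (μ α β))
        + μ (applyEnd N α) (applyEnd N β) := by
  simp only [deformedProduct, hμ.add_left, hμ.add_right, hμ.smul_left, hμ.smul_right]
  module

variable [FiniteDimensional ℝ E]

theorem eventually_isInvertible_pencil (N : CotangentEndomorphisms E M) (x : M) :
    ∀ᶠ t in 𝓝[≠] (0 : ℝ), (t • ContinuousLinearMap.id ℝ (CotangentFiber E x) + N x).IsInvertible :=
  eventually_isInvertible_smul_id_add (V := E →L[ℝ] ℝ) (N x)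

theorem IsSaletan.exists_isContraction (hμ : IsBilinearMap ℝ μ)
    (hN : IsSaletan μ N) : ∃ ν, IsContraction μ N ν := by
  choose τ hτ hNτ using hN
  refine ⟨fun α β => deformedProduct μ N α β + τ α β, fun α β x => ?_⟩
  let U (t : ℝ) := t • ContinuousLinearMap.id ℝ (CotangentFiber E x) + N x
  have hU (t : ℝ) : μ (t • α + applyEnd N α) (t • β + applyEnd N β) x =
      U t (t • μ α β x + deformedProduct μ N α β x) + N x (τ α β x) := by
    have ht : μ (applyEnd N α) (applyEnd N β) =
        applyEnd N (deformedProduct μ N α β) + applyEnd N (τ α β) := by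
      rw [hNτ, torsion, add_sub_cancel]
    rw [apply_pencil_apply_pencil hμ, ht]
    simp only [ContMDiffSection.coe_add, ContMDiffSection.coe_smul, Pi.add_apply, Pi.smul_apply,
      applyEnd_apply, U, add_apply, smul_apply, ContinuousLinearMap.id_apply,
      ContinuousLinearMap.map_add, ContinuousLinearMap.map_smul]
    module
  have hlim : Tendsto (fun t : ℝ => t • μ α β x + deformedProduct μ N α β x
      + (U t).inverse (N x (τ α β x))) (𝓝[≠] 0)
      (𝓝 ((0 : ℝ) • μ α β x + deformedProduct μ N α β x + τ α β x)) := by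
    refine Tendsto.add ?_ (tendsto_inverse_smul_id_add_apply (V := E →L[ℝ] ℝ) (N x) (hτ α β x))
    exact (Continuous.tendsto (by fun_prop) 0).mono_left nhdsWithin_le_nhds
  rw [zero_smul, zero_add] at hlim
  refine hlim.congr' ?_
  filter_upwards [eventually_isInvertible_pencil N x] with t ht
  rw [hU, ContinuousLinearMap.map_add, ht.inverse_apply_self]

theorem IsContraction.applyEnd_eq (hμ : IsBilinearMap ℝ μ)
    (hν : IsContraction μ N ν) (α β : OneForms E M) :
    applyEnd N (ν α β) = μ (applyEnd N α) (applyEnd N β) := by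
  refine ContMDiffSection.ext fun x => ?_
  let U (t : ℝ) := t • ContinuousLinearMap.id ℝ (CotangentFiber E x) + N x
  let m (t : ℝ) := μ (t • α + applyEnd N α) (t • β + applyEnd N β) x
  have hUm : Tendsto (fun t => U t ((U t).inverse (m t))) (𝓝[≠] 0) (𝓝 (applyEnd N (ν α β) x)) := by
    have hid : Tendsto (fun t : ℝ => t) (𝓝[≠] 0) (𝓝 0) := tendsto_id'.2 nhdsWithin_le_nhds
    have := (hid.smul (hν α β x)).add (((N x).continuous.tendsto _).comp (hν α β x))
    rwa [zero_smul, zero_add] at this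
  have hm : Tendsto m (𝓝[≠] 0) (𝓝 (μ (applyEnd N α) (applyEnd N β) x)) := by
    have hc : Continuous m := by
      simp only [m, apply_pencil_apply_pencil hμ, ContMDiffSection.coe_add,
        ContMDiffSection.coe_smul, Pi.add_apply, Pi.smul_apply]
      fun_prop
    have h0 : m 0 = μ (applyEnd N α) (applyEnd N β) x := by
      simp only [m, zero_smul ℝ α, zero_smul ℝ β, zero_add]
    exact h0 ▸ (hc.tendsto 0).mono_left nhdsWithin_le_nhds
  refine tendsto_nhds_unique (hUm.congr' ?_) hm
  filter_upwards [eventually_isInvertible_pencil N x] with t ht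
  exact ht.self_apply_inverse _

theorem IsContraction.hasAnchor (hν : IsContraction μ N ν) (hμ : HasAnchor μ ρ) :
    HasAnchor ν (compEnd ρ N) := by
  intro α β f
  refine ContMDiffSection.ext fun x => ?_
  let U (t : ℝ) := t • ContinuousLinearMap.id ℝ (CotangentFiber E x) + N x
  let m (t : ℝ) := μ (t • α + applyEnd N α) (t • β + applyEnd N β) x
  let c (t : ℝ) := derivAlong (sharp ρ (t • α + applyEnd N α)) f x
  have hc : Tendsto c (𝓝[≠] 0) (𝓝 (derivAlong (sharp (compEnd ρ N) α) f x)) := by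
    have hcont : Continuous c :=
      ((differential f x).comp (ρ x)).continuous.comp
        (by fun_prop : Continuous fun t : ℝ => t • α x + N x (α x))
    have h0 : c 0 = derivAlong (sharp (compEnd ρ N) α) f x := by
      simp only [c, zero_smul ℝ α, zero_add]
      rfl
    exact h0 ▸ (hcont.tendsto 0).mono_left nhdsWithin_le_nhds
  have hlim : Tendsto (fun t => f x • (U t).inverse (m t) + c t • β x) (𝓝[≠] 0)
      (𝓝 ((f • ν α β + derivAlong (sharp (compEnd ρ N) α) f • β) x)) :=
    ((hν α β x).const_smul (f x)).add (hc.smul_const (β x))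
  refine tendsto_nhds_unique (hν α (f • β) x) (hlim.congr' ?_)
  filter_upwards [eventually_isInvertible_pencil N x] with t ht
  have hf : t • (f • β) + applyEnd N (f • β) = f • (t • β + applyEnd N β) := by
    rw [applyEnd_smul]
    exact ContMDiffSection.ext fun y => by
      simp [smulSection_apply, smul_comm t (f y)]
  have hm : μ (t • α + applyEnd N α) (t • (f • β) + applyEnd N (f • β)) x =
      f x • m t + c t • U t (β x) := by
    rw [hf, hμ]
    rfl
  rw [hm, ContinuousLinearMap.map_add, ContinuousLinearMap.map_smul, ContinuousLinearMap.map_smul,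
    ht.inverse_apply_self]

end Contraction

section Poisson

/-- Skew-symmetric contravariant 2-tensors. -/
def IsSkew (P : ContravariantTensors E M) : Prop :=
  ∀ (x : M) (α β : CotangentFiber E x), β (P x α) = -α (P x β)

variable {P : ContravariantTensors E M}

theorem sharp_add (P : ContravariantTensors E M) (α β : OneForms E M) :
    sharp P (α + β) = sharp P α + sharp P β :=
  ContMDiffSection.ext fun x => (P x).map_add (α x) (β x)

theorem sharp_smul (P : ContravariantTensors E M) (f : C^∞⟮𝓘(ℝ, E), M; ℝ⟯) (α : OneForms E M) :
    sharp P (f • α) = f • sharp P α :=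
  ContMDiffSection.ext fun x => (P x).map_smul (f x) (α x)

theorem pairing_add_right (P : ContravariantTensors E M) (α β γ : OneForms E M) :
    pairing P α (β + γ) = pairing P α β + pairing P α γ :=
  rfl

theorem pairing_smul_right (P : ContravariantTensors E M) (f : C^∞⟮𝓘(ℝ, E), M; ℝ⟯)
    (α β : OneForms E M) : pairing P α (f • β) = f * pairing P α β :=
  rfl

theorem IsSkew.pairing_swap (hP : IsSkew P) (α β : OneForms E M) :
    pairing P α β = -pairing P β α :=
  ContMDiffMap.ext fun x => hP x (α x) (β x)

theorem poissonBracket_eq_derivAlong (P : ContravariantTensors E M)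
    (f g : C^∞⟮𝓘(ℝ, E), M; ℝ⟯) :
    poissonBracket P f g = derivAlong (sharp P (differential f)) g :=
  rfl

variable [FiniteDimensional ℝ E]

theorem IsSkew.cotangentBracket_swap (hP : IsSkew P) (α β : OneForms E M) :
    cotangentBracket P α β = -cotangentBracket P β α := by
  rw [cotangentBracket, hP.pairing_swap, differential_neg, cotangentBracket]
  abel

theorem IsSkew.hasAnchor_cotangentBracket (hP : IsSkew P) :
    HasAnchor (cotangentBracket P) P := by
  intro α β f
  have hα : applyOneForm α (sharp P β) = -pairing P α β := hP.pairing_swap β α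
  rw [cotangentBracket, sharp_smul, lieDerivative_smul_left, lieDerivative_smul_right,
    pairing_smul_right, differential_mul, hα, cotangentBracket]
  refine ContMDiffSection.ext fun x => ?_
  simp only [ContMDiffSection.coe_add, ContMDiffSection.coe_sub, Pi.add_apply, Pi.sub_apply,
    smulSection_apply, ContMDiffMap.coe_neg, Pi.neg_apply]
  module

theorem cotangentBracket_add_right (P : ContravariantTensors E M) (α β γ : OneForms E M) :
    cotangentBracket P α (β + γ) = cotangentBracket P α β + cotangentBracket P α γ := by
  simp only [cotangentBracket, sharp_add, lieDerivative_add_left, lieDerivative_add_right,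
    pairing_add_right, differential_add]
  abel

theorem IsSkew.cotangentBracket_const_smul_right (hP : IsSkew P) (c : ℝ) (α β : OneForms E M) :
    cotangentBracket P α (c • β) = c • cotangentBracket P α β := by
  have h := hP.hasAnchor_cotangentBracket α β (ContMDiffMap.const c)
  have h0 : derivAlong (sharp P α) (ContMDiffMap.const c) • β = 0 := by
    refine ContMDiffSection.ext fun x => ?_
    rw [smulSection_apply, derivAlong, differential_const]
    exact zero_smul ℝ (β x)
  rw [h0, add_zero] at h
  exact h

theorem IsSkew.isBilinearMap_cotangentBracket (hP : IsSkew P) :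
    IsBilinearMap ℝ (cotangentBracket P) where
  add_left α β γ := by
    rw [hP.cotangentBracket_swap, cotangentBracket_add_right, neg_add,
      ← hP.cotangentBracket_swap, ← hP.cotangentBracket_swap]
  smul_left c α β := by
    rw [hP.cotangentBracket_swap (c • α) β, hP.cotangentBracket_const_smul_right,
      hP.cotangentBracket_swap α β]
    module
  add_right := cotangentBracket_add_right P
  smul_right := hP.cotangentBracket_const_smul_right

/-- The vector field `[P(α), P(β)] - P(μ^P(α, β))`, which measures the failure of `P` to map the
bracket of 1-forms to the Lie bracket of vector fields. -/
def anchorDefect (P : ContravariantTensors E M) (α β : OneForms E M) : VectorFields E M :=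
  lieBracket (sharp P α) (sharp P β) - sharp P (cotangentBracket P α β)

/-- The term `⟨γ, [P(α), P(β)]⟩ + P(α)⟨β, P(γ)⟩`, whose sum over the cyclic permutations of
`α, β, γ` is `⟨γ, anchorDefect P α β⟩` when `P` is skew-symmetric. -/
def cyclicTerm (P : ContravariantTensors E M) (α β γ : OneForms E M) : C^∞⟮𝓘(ℝ, E), M; ℝ⟯ :=
  applyOneForm γ (lieBracket (sharp P α) (sharp P β)) + derivAlong (sharp P α) (pairing P γ β)

theorem IsSkew.applyOneForm_anchorDefect (hP : IsSkew P) (α β γ : OneForms E M) :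
    applyOneForm γ (anchorDefect P α β) =
      cyclicTerm P α β γ + cyclicTerm P β γ α + cyclicTerm P γ α β := by
  have hγ : applyOneForm γ (sharp P (cotangentBracket P α β)) =
      -(applyOneForm (lieDerivative (sharp P α) β) (sharp P γ)
        - applyOneForm (lieDerivative (sharp P β) α) (sharp P γ)
        - derivAlong (sharp P γ) (pairing P α β)) :=
    hP.pairing_swap (cotangentBracket P α β) γ
  have hαγ : derivAlong (sharp P β) (applyOneForm α (sharp P γ)) =
      -derivAlong (sharp P β) (pairing P α γ) := by
    rw [← derivAlong_neg, ← hP.pairing_swap]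
    rfl
  have hαβ : derivAlong (sharp P γ) (pairing P α β) =
      -derivAlong (sharp P γ) (pairing P β α) := by
    rw [← derivAlong_neg, ← hP.pairing_swap]
  have hβ : applyOneForm β (lieBracket (sharp P γ) (sharp P α)) =
      -applyOneForm β (lieBracket (sharp P α) (sharp P γ)) := by
    rw [← applyOneForm_neg, ← lieBracket_swap]
  rw [anchorDefect, applyOneForm_sub, hγ, applyOneForm_lieDerivative, applyOneForm_lieDerivative,
    hαγ, hαβ, cyclicTerm, cyclicTerm, cyclicTerm, hβ]
  simp only [pairing]
  abel

theorem IsSkew.applyOneForm_anchorDefect_rotate (hP : IsSkew P) (α β γ : OneForms E M) :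
    applyOneForm γ (anchorDefect P α β) = applyOneForm α (anchorDefect P β γ) := by
  rw [hP.applyOneForm_anchorDefect, hP.applyOneForm_anchorDefect]
  abel

theorem IsSkew.cyclicTerm_differential (hP : IsSkew P) (f g h : C^∞⟮𝓘(ℝ, E), M; ℝ⟯) :
    cyclicTerm P (differential f) (differential g) (differential h) =
      poissonBracket P g (poissonBracket P h f) := by
  have hswap (u v : C^∞⟮𝓘(ℝ, E), M; ℝ⟯) : poissonBracket P u v = -poissonBracket P v u :=
    hP.pairing_swap _ _
  calc cyclicTerm P (differential f) (differential g) (differential h)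
    _ = derivAlong (lieBracket (sharp P (differential f)) (sharp P (differential g))) h
        + poissonBracket P f (poissonBracket P h g) := rfl
    _ = poissonBracket P f (poissonBracket P g h) - poissonBracket P g (poissonBracket P f h)
        + poissonBracket P f (poissonBracket P h g) := by
      rw [derivAlong_lieBracket]
      rfl
    _ = poissonBracket P g (poissonBracket P h f) := by
      rw [hswap g h, hswap f h]
      simp only [poissonBracket_eq_derivAlong P f, poissonBracket_eq_derivAlong P g, derivAlong_neg]
      abel

theorem IsSkew.applyOneForm_anchorDefect_differential (hP : IsSkew P)
    (f g h : C^∞⟮𝓘(ℝ, E), M; ℝ⟯) :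
    applyOneForm (differential h) (anchorDefect P (differential f) (differential g)) =
      poissonBracket P f (poissonBracket P g h) + poissonBracket P g (poissonBracket P h f)
        + poissonBracket P h (poissonBracket P f g) := by
  rw [hP.applyOneForm_anchorDefect, hP.cyclicTerm_differential, hP.cyclicTerm_differential,
    hP.cyclicTerm_differential]
  abel

-- By cyclicity `⟨γ, anchorDefect P α β⟩` depends only on the values of `α`, `β` and `γ` at the
-- point, so it suffices to know it on differentials.
theorem IsPoisson.anchorDefect_eq_zero [T2Space M] (hP : IsPoisson P) (α β : OneForms E M) :
    anchorDefect P α β = 0 := by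
  have hskew : IsSkew P := hP.skew
  refine ContMDiffSection.ext fun x => tangent_eq_of_forall_differential fun h => ?_
  obtain ⟨f, hf⟩ := exists_differential_eq (α x)
  obtain ⟨g, hg⟩ := exists_differential_eq (β x)
  calc differential h x (anchorDefect P α β x)
    _ = α x (anchorDefect P β (differential h) x) :=
      DFunLike.congr_fun (hskew.applyOneForm_anchorDefect_rotate α β (differential h)) x
    _ = β x (anchorDefect P (differential h) (differential f) x) := by
      rw [← hf]
      exact DFunLike.congr_fun
        (hskew.applyOneForm_anchorDefect_rotate β (differential h) (differential f)) x
    _ = 0 := by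
      have := hskew.applyOneForm_anchorDefect_differential h f g
      rw [hP.jacobi] at this
      rw [← hg]
      exact DFunLike.congr_fun this x
    _ = differential h x (0 : TangentSpace 𝓘(ℝ, E) x) := (map_zero _).symm

theorem isPoisson_iff [T2Space M] :
    IsPoisson P ↔ IsSkew P ∧
      ∀ α β, sharp P (cotangentBracket P α β) = lieBracket (sharp P α) (sharp P β) := by
  constructor
  · exact fun hP => ⟨hP.skew, fun α β => (sub_eq_zero.1 (hP.anchorDefect_eq_zero α β)).symm⟩
  · rintro ⟨hskew, hbracket⟩
    refine ⟨hskew, fun f g h => ?_⟩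
    rw [← hskew.applyOneForm_anchorDefect_differential, anchorDefect, hbracket, sub_self]
    exact ContMDiffMap.ext fun x => map_zero (differential h x)

theorem IsSkew.isSkew_compEnd_iff (hP : IsSkew P) {N : CotangentEndomorphisms E M} :
    IsSkew (compEnd P N) ↔ ∀ x, (P x).comp (N x) = (dualEnd N x).comp (P x) := by
  have hdual (x : M) (α β : CotangentFiber E x) : β (dualEnd N x (P x α)) = -α (P x (N x β)) :=
    (apply_dualEnd N x β (P x α)).trans (hP x α (N x β))
  constructor
  · exact fun h x => ContinuousLinearMap.ext fun α =>
      (SeparatingDual.eq_iff_forall_dual_eq (R := ℝ) (V := E)).2 fun β =>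
        (h x α β).trans (hdual x α β).symm
  · exact fun h x α β => (congrArg β (DFunLike.congr_fun (h x) α)).trans (hdual x α β)

end Poisson

section PoissonContractions

variable [FiniteDimensional ℝ E] {P P₁ : ContravariantTensors E M}
  {N : CotangentEndomorphisms E M}

theorem IsContraction.eq_compEnd [T2Space M] (hP : IsSkew P) (hP₁ : IsSkew P₁)
    (h : IsContraction (cotangentBracket P) N (cotangentBracket P₁)) : P₁ = compEnd P N :=
  hP₁.hasAnchor_cotangentBracket.unique (h.hasAnchor hP.hasAnchor_cotangentBracket)

theorem IsContraction.isPoisson_compEnd [T2Space M] (hP : IsPoisson P)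
    (hPN : IsSkew (compEnd P N))
    (h : IsContraction (cotangentBracket P) N (cotangentBracket (compEnd P N))) :
    IsPoisson (compEnd P N) := by
  obtain ⟨hskew, hbracket⟩ := isPoisson_iff.1 hP
  refine isPoisson_iff.2 ⟨hPN, fun α β => ?_⟩
  calc sharp P (applyEnd N (cotangentBracket (compEnd P N) α β))
    _ = sharp P (cotangentBracket P (applyEnd N α) (applyEnd N β)) := by
      rw [h.applyEnd_eq hskew.isBilinearMap_cotangentBracket]
    _ = lieBracket (sharp P (applyEnd N α)) (sharp P (applyEnd N β)) := hbracket _ _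

end PoissonContractions

end PoissonContraction

end

theorem theorem14 {E : Type*} [NormedAddCommGroup E] [NormedSpace ℝ E] [FiniteDimensional ℝ E]
    {M : Type*} [TopologicalSpace M] [T2Space M] [ChartedSpace E M] [IsManifold 𝓘(ℝ, E) ∞ M]
    (P : ContravariantTensors E M) (hP : IsPoisson P)
    (N : CotangentEndomorphisms E M) (hN : IsSaletan (cotangentBracket P) N) :
    ∃ ν : OneForms E M → OneForms E M → OneForms E M,
      IsContraction (cotangentBracket P) N ν ∧
      ((∃ P₁ : ContravariantTensors E M, IsPoisson P₁ ∧ ν = cotangentBracket P₁) ↔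
        (∀ x : M, (P x).comp (N x) = (dualEnd N x).comp (P x)) ∧
          ν = cotangentBracket (compEnd P N)) ∧
      (∀ P₁ : ContravariantTensors E M,
        IsPoisson P₁ → ν = cotangentBracket P₁ → P₁ = compEnd P N) := by
  have hskew : IsSkew P := hP.skew
  obtain ⟨ν, hν⟩ := hN.exists_isContraction hskew.isBilinearMap_cotangentBracket
  have hunique (P₁ : ContravariantTensors E M) (hP₁ : IsPoisson P₁)
      (h : ν = cotangentBracket P₁) : P₁ = compEnd P N :=
    (h ▸ hν).eq_compEnd hskew hP₁.skew
  refine ⟨ν, hν, ⟨?_, ?_⟩, hunique⟩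
  · rintro ⟨P₁, hP₁, h⟩
    obtain rfl := hunique P₁ hP₁ h
    exact ⟨hskew.isSkew_compEnd_iff.1 hP₁.skew, h⟩
  · rintro ⟨hcomm, rfl⟩
    exact ⟨compEnd P N, hν.isPoisson_compEnd hP (hskew.isSkew_compEnd_iff.2 hcomm), rfl⟩
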